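/- **Setting.** Let $M$ be a topological space (for instance the spatial manifold $\Sigma$) and let $G$ be a locally compact Hausdorff group that is unimodular. *Graphs.* An edge is a continuous curve $\gamma:[0,1]\to M$ without self-intersections, except that possibly $\gamma(0)=\gamma(1)$. Its source is $\gamma(0)$ and its target is $\gamma(1)$. A graph $\Gamma=\{\gamma_1,\dots,\gamma_N\}$ consists of finitely many edges such that distinct edges meet at most in sources or targets. The path groupoid of $\Gamma$ is the groupoid freely generated by $\gamma_1,\dots,\gamma_N$ over the set of vertices. A holonomy map is a map $\mathfrak h$ from the path groupoid to $G$ with $\mathfrak h(\gamma\circ\gamma')=\mathfrak h(\gamma)\mathfrak h(\gamma')$ whenever $\gamma$ ends where $\gamma'$ starts. The configuration space is $$\bar{\mathcal A}_\Gamma=\{(\mathfrak h(\gamma_1),\dots,\mathfrak h(\gamma_N)) : \mathfrak h \text{ a holonomy map}\}\subseteq G^N$$ with the topology of $G^N$, and $C_0(\bar{\mathcal A}_\Gamma)$ is the $C^*$-algebra of complex continuous functions on it that vanish at infinity. *Surfaces.* An oriented surface is a subset $S\subseteq M$ together with disjoint open sets "above $S$" and "below $S$", both disjoint from $S$, such that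 their union with $S$ is open and $S$ lies in the closure of each. An edge is outgoing (ingoing) with respect to $S$ if its source (target) lies on $S$; it lies above (below) $S$ there if $\gamma(t)$ is above (below) $S$ for all $t$ close to, but different from, the parameter of that end point. Put $\iota_L(S,\gamma)=1$ ($-1$) if $\gamma$ is outgoing and lies above (below) $S$, $\iota_R(S,\gamma)=-1$ ($1$) if $\gamma$ is ingoing and lies above (below) $S$, and $0$ in all other cases. Surfaces $\breve S=\{S_1,\dots,S_N\}$ have the *simple surface intersection property* for $\Gamma$ if each $\gamma_i$ meets $S_i$ exactly once, namely in its target, lies above $S_i$ there, and meets no $S_j$ with $j\neq i$. *Flux group.* $\bar G_{\breve S,\Gamma}\subseteq (G\times G)^N$ is the group of all finite products of tuples $(\rho_S(\gamma_1),\dots,\rho_S(\gamma_N))$ with $\rho_S(\gamma)=(o_L(S)^{\iota_L(S,\gamma)},o_R(S)^{\iota_R(S,\gamma)})$, where $S\in\breve S$ and $o_L,o_R:\breve S\to G$ are arbitrary maps. It carries the subspace topology and a (regular) Haar measure $\mu=\mu_{\breve S,\Gamma}$ with any normalisation. Under the simple surface intersection property the first components are trivial; an element of $\bar G_{\breve S,\Gamma}$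 is then written $\rho=(\rho_{S_1}(\gamma_1),\dots,\rho_{S_N}(\gamma_N))\in G^N$, using the second components. The left action on $C_0(\bar{\mathcal A}_\Gamma)$ is $$(\alpha^N_{\overleftarrow L}(\rho)f)(\mathfrak h(\gamma_1),\dots,\mathfrak h(\gamma_N))=f(\rho_{S_1}(\gamma_1)^{-1}\mathfrak h(\gamma_1),\dots,\rho_{S_N}(\gamma_N)^{-1}\mathfrak h(\gamma_N)).$$ A triple $(K,A,\alpha)$ is a $C^*$-dynamical system if $K$ is a locally compact group, $A$ a $C^*$-algebra and $\alpha$ a homomorphism from $K$ to the group of $*$-automorphisms of $A$ such that $\rho\mapsto\alpha(\rho)a$ is norm continuous for every $a\in A$. $L^1(K,A,\alpha)$ denotes the space of (strongly measurable) integrable functions $F:K\to A$ modulo null functions, with pointwise linear structure and norm $\|F\|_1=\int_K\|F(\rho)\|\,d\mu(\rho)$. **Proposition.** Let $\breve S=\{S_1,\dots,S_N\}$ have the simple surface intersection property for $\Gamma$. Then $(\bar G_{\breve S,\Gamma},C_0(\bar{\mathcal A}_\Gamma),\alpha^N_{\overleftarrow L})$ is a $C^*$-dynamical system. Moreover, for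 $\alpha=\alpha^N_{\overleftarrow L}$, and likewise for every $\alpha$ for which $(\bar G_{\breve S,\Gamma},C_0(\bar{\mathcal A}_\Gamma),\alpha)$ is a $C^*$-dynamical system, the following holds. For all integrable $F,\hat F:\bar G_{\breve S,\Gamma}\to C_0(\bar{\mathcal A}_\Gamma)$ the integral $$(F*\hat F)(\tilde\rho)=\int_{\bar G_{\breve S,\Gamma}}F(\rho)\,\alpha(\rho)\big(\hat F(\rho^{-1}\tilde\rho)\big)\,d\mu(\rho)$$ converges absolutely for almost every $\tilde\rho$. This product and the involution $$F^*(\rho)=\alpha(\rho)\big(F^+(\rho^{-1})\big),\qquad F^+(\rho)=\overline{F(\rho)},$$ are well defined on $L^1(\bar G_{\breve S,\Gamma},C_0(\bar{\mathcal A}_\Gamma),\alpha)$ and turn it into a Banach $*$-algebra: it is complete, the product is bilinear and associative with $\|F*\hat F\|_1\le\|F\|_1\|\hat F\|_1$, and the involution is conjugate linear, isometric and involutive with $(F*\hat F)^*=\hat F^{*}*F^{*}$. -/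

import Mathlib

open MeasureTheory Topology Filter CategoryTheory
open scoped ZeroAtInfty

universe u v

namespace HolonomyFlux

/-! ### Curves, graphs and oriented surfaces in the space `M` -/

/-- An edge in `M`, given by a parametrised representative: a continuous curve on `[0,1]` without
self-intersections, except that source and target may coincide. No differentiability is demanded,
so that `C^k`, analytic and semi-analytic edges are all included. -/
structure Edge (M : Type u) [TopologicalSpace M] where
  toFun : C(unitInterval, M)
  simple : ∀ s t : unitInterval, toFun s = toFun t →
    s = t ∨ (s = 0 ∧ t = 1) ∨ (s = 1 ∧ t = 0)

/-- Source vertex of an edge. -/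
def Edge.source {M : Type u} [TopologicalSpace M] (e : Edge M) : M := e.toFun 0

/-- Target vertex of an edge. -/
def Edge.target {M : Type u} [TopologicalSpace M] (e : Edge M) : M := e.toFun 1

/-- A graph in `M` with `N` independent edges: distinct edges meet at most in source or target
points. -/
structure Graph (M : Type u) [TopologicalSpace M] (N : ℕ) where
  edge : Fin N → Edge M
  independent : ∀ i j, i ≠ j → ∀ s t : unitInterval, (edge i).toFun s = (edge j).toFun t →
    (s = 0 ∨ s = 1) ∧ (t = 0 ∨ t = 1)

/-- An oriented surface in `M`: a two-sided subset together with the choice of its upper and lower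
side in a neighbourhood. A co-oriented embedded hypersurface of a manifold, with the two sides of a
tubular neighbourhood, is of this form. -/
structure OrientedSurface (M : Type u) [TopologicalSpace M] where
  carrier : Set M
  above : Set M
  below : Set M
  isOpen_above : IsOpen above
  isOpen_below : IsOpen below
  isOpen_neighbourhood : IsOpen (carrier ∪ above ∪ below)
  disjoint_above_below : Disjoint above below
  disjoint_carrier_above : Disjoint carrier above
  disjoint_carrier_below : Disjoint carrier below
  carrier_subset_above : carrier ⊆ closure above
  carrier_subset_below : carrier ⊆ closure below

section Intersection

variable {M : Type u} [TopologicalSpace M]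

/-- The edge is outgoing with respect to `S`, and its initial part lies in the side `U`. -/
def OutgoingIn (S : OrientedSurface M) (U : Set M) (e : Edge M) : Prop :=
  e.source ∈ S.carrier ∧ ∀ᶠ t in 𝓝[>] (0 : unitInterval), e.toFun t ∈ U

/-- The edge is ingoing with respect to `S`, and its final part lies in the side `U`. -/
def IngoingIn (S : OrientedSurface M) (U : Set M) (e : Edge M) : Prop :=
  e.target ∈ S.carrier ∧ ∀ᶠ t in 𝓝[<] (1 : unitInterval), e.toFun t ∈ U

open Classical in
/-- The intersection function `ι_L`: `1` (`-1`) for edges that are outgoing and lie above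
(below) the surface, `0` otherwise. -/
noncomputable def iotaL (S : OrientedSurface M) (e : Edge M) : ℤ :=
  if OutgoingIn S S.above e then 1 else if OutgoingIn S S.below e then -1 else 0

open Classical in
/-- The intersection function `ι_R`: `-1` (`1`) for edges that are ingoing and lie above
(below) the surface, `0` otherwise. -/
noncomputable def iotaR (S : OrientedSurface M) (e : Edge M) : ℤ :=
  if IngoingIn S S.above e then -1 else if IngoingIn S S.below e then 1 else 0

/-- The simple surface intersection property of the surfaces `S_1, …, S_N` for a graph with edges
`γ_1, …, γ_N`: the edge `γ_i` meets the surface `S_i` only once, in its target vertex, it lies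
above `S_i`, and it meets no other surface of the set. -/
structure SimpleSurfaceIntersectionProperty {N : ℕ} (Γ : Graph M N)
    (S : Fin N → OrientedSurface M) : Prop where
  mem_iff : ∀ i j (t : unitInterval), (Γ.edge i).toFun t ∈ (S j).carrier ↔ i = j ∧ t = 1
  lies_above : ∀ i, IngoingIn (S i) (S i).above (Γ.edge i)

end Intersection

/-! ### The flux group -/

section Flux

variable {M : Type u} [TopologicalSpace M] (G : Type v) [Group G]

/-- The values `(ρ_S(γ_1), …, ρ_S(γ_N))` of the group-valued quantum fluxes on the graph, where
`ρ_S(γ) = (o_L(S) ^ ι_L(S,γ), o_R(S) ^ ι_R(S,γ))` with arbitrary maps `o_L`, `o_R` from the set of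
surfaces to `G`. -/
def fluxImages {N : ℕ} (Γ : Graph M N) {J : Type} (S : J → OrientedSurface M) :
    Set (Fin N → G × G) :=
  {x | ∃ (oL oR : J → G) (j : J), ∀ i,
    x i = (oL j ^ iotaL (S j) (Γ.edge i), oR j ^ iotaR (S j) (Γ.edge i))}

/-- The flux group: all finite products of values of group-valued quantum fluxes. -/
def fluxGroup {N : ℕ} (Γ : Graph M N) {J : Type} (S : J → OrientedSurface M) :
    Subgroup (Fin N → G × G) :=
  { Submonoid.closure (fluxImages G Γ S) with
    inv_mem' := by
      intro x hx
      change x ∈ Submonoid.closure (fluxImages G Γ S) at hx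
      change x⁻¹ ∈ Submonoid.closure (fluxImages G Γ S)
      induction hx using Submonoid.closure_induction with
      | mem x h =>
        obtain ⟨oL, oR, j, h⟩ := h
        refine Submonoid.subset_closure ⟨oL⁻¹, oR⁻¹, j, fun i => ?_⟩
        simp [h i]
      | one => simp
      | mul x y _ _ hx hy =>
        rw [mul_inv_rev]
        exact mul_mem hy hx }

end Flux

/-! ### Holonomies and the configuration space -/

section Holonomy

variable {M : Type u} [TopologicalSpace M]

/-- The vertices of a graph. -/
def Graph.Vertex {N : ℕ} (Γ : Graph M N) : Type u :=
  {x : M // ∃ i, x = (Γ.edge i).source ∨ x = (Γ.edge i).target}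

instance Graph.quiver {N : ℕ} (Γ : Graph M N) : Quiver Γ.Vertex where
  Hom a b := {i : Fin N // (Γ.edge i).source = a.1 ∧ (Γ.edge i).target = b.1}

/-- The path groupoid of a graph, freely generated by its edges. -/
abbrev Graph.PathGroupoid {N : ℕ} (Γ : Graph M N) : Type u := Quiver.FreeGroupoid Γ.Vertex

/-- The edge `γ_i` as an element of the path groupoid. -/
def Graph.path {N : ℕ} (Γ : Graph M N) (i : Fin N) :
    (Quiver.FreeGroupoid.of Γ.Vertex).obj ⟨(Γ.edge i).source, i, Or.inl rfl⟩ ⟶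
      (Quiver.FreeGroupoid.of Γ.Vertex).obj ⟨(Γ.edge i).target, i, Or.inr rfl⟩ :=
  (Quiver.FreeGroupoid.of Γ.Vertex).map (X := ⟨(Γ.edge i).source, i, Or.inl rfl⟩)
    (Y := ⟨(Γ.edge i).target, i, Or.inr rfl⟩) ⟨i, rfl, rfl⟩

/-- A holonomy map: a groupoid morphism from the path groupoid to the group `G`, the composition
`p ≫ q` being the path that runs through `p` first. -/
structure HolonomyMap (G : Type v) [Group G] {N : ℕ} (Γ : Graph M N) where
  hol : ∀ {a b : Γ.PathGroupoid}, (a ⟶ b) → G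
  hol_comp : ∀ {a b c : Γ.PathGroupoid} (p : a ⟶ b) (q : b ⟶ c),
    hol (p ≫ q) = hol p * hol q

/-- The configuration space of generalised connections: all tuples `(𝔥(γ_1), …, 𝔥(γ_N)) ∈ G^N` for
holonomy maps `𝔥`, with the topology of `G^N`. -/
def configSpace (G : Type v) [Group G] {N : ℕ} (Γ : Graph M N) : Set (Fin N → G) :=
  {x | ∃ h : HolonomyMap G Γ, ∀ i, x i = h.hol (Γ.path i)}

/-- Since the edges generate the path groupoid freely, every tuple is a tuple of holonomies. -/
theorem mem_configSpace (G : Type v) [Group G] {N : ℕ} (Γ : Graph M N) (x : Fin N → G) :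
    x ∈ configSpace G Γ := by
  let φ : Γ.Vertex ⥤q SingleObj Gᵐᵒᵖ :=
    { obj := fun _ => SingleObj.star _
      map := fun {a b} e => (MulOpposite.op (x e.1) : Gᵐᵒᵖ) }
  let F : Γ.PathGroupoid ⥤ SingleObj Gᵐᵒᵖ := Quiver.FreeGroupoid.lift φ
  refine ⟨⟨fun {a b} p => MulOpposite.unop (show Gᵐᵒᵖ from F.map p), ?_⟩, ?_⟩
  · intro a b c p q
    have h := F.map_comp p q
    rw [SingleObj.comp_as_mul] at h
    exact congrArg MulOpposite.unop h
  · intro i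
    exact congrArg MulOpposite.unop (mul_one (MulOpposite.op (x i))).symm

end Holonomy

/-! ### The left action of the flux group on the analytic holonomy algebra -/

section Action

variable {M : Type u} [TopologicalSpace M] {G : Type v} [Group G] [TopologicalSpace G]
  [IsTopologicalGroup G]

/-- Left translation `(𝔥(γ_1), …, 𝔥(γ_N)) ↦ (g_1 𝔥(γ_1), …, g_N 𝔥(γ_N))` of the configuration
space. -/
def leftTranslation {N : ℕ} (Γ : Graph M N) (g : Fin N → G) :
    configSpace G Γ ≃ₜ configSpace G Γ where
  toFun h := ⟨g * h.1, mem_configSpace G Γ _⟩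
  invFun h := ⟨g⁻¹ * h.1, mem_configSpace G Γ _⟩
  left_inv h := Subtype.ext (inv_mul_cancel_left g h.1)
  right_inv h := Subtype.ext (mul_inv_cancel_left g h.1)
  continuous_toFun := by fun_prop
  continuous_invFun := by fun_prop

/-- The automorphism of `C₀(X)` induced by a homeomorphism of `X`. -/
noncomputable def compHomeo {X : Type*} [TopologicalSpace X] (e : X ≃ₜ X) :
    C₀(X, ℂ) ≃⋆ₐ[ℂ] C₀(X, ℂ) where
  toFun f := f.comp e.toCocompactMap
  invFun f := f.comp e.symm.toCocompactMap
  left_inv f := by ext x; simp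
  right_inv f := by ext x; simp
  map_add' _ _ := rfl
  map_mul' _ _ := rfl
  map_star' _ := rfl
  map_smul' _ _ := rfl

/-- The components `(ρ_{S_1}(γ_1), …, ρ_{S_N}(γ_N)) ∈ G^N` of an element of the flux group that
belong to ingoing edges. Under the simple surface intersection property the components that belong
to outgoing edges are trivial. -/
def ingoingFlux {N : ℕ} {Γ : Graph M N} {J : Type} {S : J → OrientedSurface M}
    (ρ : fluxGroup G Γ S) : Fin N → G := fun i => (ρ.1 i).2

/-- The left action of the flux group on the analytic holonomy algebra,
`(α(ρ) f)(𝔥) = f(ρ_{S_1}(γ_1)⁻¹ 𝔥(γ_1), …, ρ_{S_N}(γ_N)⁻¹ 𝔥(γ_N))`. -/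
noncomputable def leftAction {N : ℕ} (Γ : Graph M N) {J : Type} (S : J → OrientedSurface M) :
    fluxGroup G Γ S →* (C₀(configSpace G Γ, ℂ) ≃⋆ₐ[ℂ] C₀(configSpace G Γ, ℂ)) where
  toFun ρ := compHomeo (leftTranslation Γ (ingoingFlux ρ)⁻¹)
  map_one' := by
    ext f x
    refine congrArg f (Subtype.ext ?_)
    funext i
    simp [leftTranslation, ingoingFlux]
  map_mul' ρ τ := by
    ext f x
    refine congrArg f (Subtype.ext ?_)
    funext i
    simp [leftTranslation, ingoingFlux, mul_assoc]

end Action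

/-! ### `C*`-dynamical systems and twisted convolution -/

/-- `(K, A, α)` is a `C*`-dynamical system: `K` is locally compact and the action `α` of `K` by
`*`-automorphisms of the `C*`-algebra `A` is point-norm continuous. -/
structure IsCStarDynamicalSystem {K : Type*} [Group K] [TopologicalSpace K] {A : Type*}
    [NonUnitalCStarAlgebra A] (α : K →* (A ≃⋆ₐ[ℂ] A)) : Prop where
  locallyCompact : LocallyCompactSpace K
  continuous_apply : ∀ a : A, Continuous fun ρ : K => α ρ a

/-- The twisted convolution `(F ∗ H)(τ) = ∫ F(ρ) α(ρ)(H(ρ⁻¹ τ)) dμ(ρ)`. -/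
noncomputable def twistedConvolution {K : Type*} [Group K] [MeasurableSpace K] {A : Type*}
    [NonUnitalCStarAlgebra A] (α : K →* (A ≃⋆ₐ[ℂ] A)) (μ : Measure K) (F H : K → A) (τ : K) : A :=
  ∫ ρ, F ρ * α ρ (H (ρ⁻¹ * τ)) ∂μ

/-- The involution `F^*(ρ) = α(ρ)(F^+(ρ⁻¹))`, where `F^+(ρ) = F(ρ)^*` pointwise. -/
def twistedInvolution {K : Type*} [Group K] {A : Type*}
    [NonUnitalCStarAlgebra A] (α : K →* (A ≃⋆ₐ[ℂ] A)) (F : K → A) (ρ : K) : A :=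
  α ρ (star (F ρ⁻¹))

/-- The complex normed space `X` is a Banach `*`-algebra (in general without unit) with the
product `mul` and the isometric involution `inv`. -/
structure IsBanachStarAlgebra {X : Type*} [NormedAddCommGroup X] [NormedSpace ℂ X]
    (mul : X → X → X) (inv : X → X) : Prop where
  complete : CompleteSpace X
  add_mul : ∀ x y z, mul (x + y) z = mul x z + mul y z
  mul_add : ∀ x y z, mul x (y + z) = mul x y + mul x z
  smul_mul : ∀ (c : ℂ) x y, mul (c • x) y = c • mul x y
  mul_smul : ∀ (c : ℂ) x y, mul x (c • y) = c • mul x y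
  mul_assoc : ∀ x y z, mul (mul x y) z = mul x (mul y z)
  norm_mul_le : ∀ x y, ‖mul x y‖ ≤ ‖x‖ * ‖y‖
  inv_inv : ∀ x, inv (inv x) = x
  inv_add : ∀ x y, inv (x + y) = inv x + inv y
  inv_smul : ∀ (c : ℂ) x, inv (c • x) = star c • inv x
  inv_mul : ∀ x y, inv (mul x y) = mul (inv y) (inv x)
  norm_inv : ∀ x, ‖inv x‖ = ‖x‖

/-- `L¹(K, A, α)`, the space of `A`-valued integrable functions modulo null functions with norm
`∫ ‖F(ρ)‖ dμ(ρ)`, is a Banach `*`-algebra whose product is the twisted convolution and whose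
involution is the twisted involution. For each pair of integrable functions the integral that
defines the convolution converges absolutely almost everywhere. -/
def IsTwistedConvolutionAlgebra {K : Type*} [Group K] [MeasurableSpace K] {A : Type*}
    [NonUnitalCStarAlgebra A] (α : K →* (A ≃⋆ₐ[ℂ] A)) (μ : Measure K) : Prop :=
  ∃ (mul : (K →₁[μ] A) → (K →₁[μ] A) → (K →₁[μ] A)) (inv : (K →₁[μ] A) → (K →₁[μ] A)),
    (∀ (F H : K → A) (hF : Integrable F μ) (hH : Integrable H μ),
      (∀ᵐ τ ∂μ, Integrable (fun ρ => F ρ * α ρ (H (ρ⁻¹ * τ))) μ) ∧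
        mul (hF.toL1 F) (hH.toL1 H) =ᵐ[μ] twistedConvolution α μ F H) ∧
    (∀ (F : K → A) (hF : Integrable F μ), inv (hF.toL1 F) =ᵐ[μ] twistedInvolution α F) ∧
    IsBanachStarAlgebra mul inv

end HolonomyFlux

open HolonomyFlux

/-!
Under the simple surface intersection property the flux group consists of all tuples whose first
components are trivial, so it is isomorphic to `G ^ N`. Its modular character is the product of the
modular characters of the factors; hence it is unimodular and `μ` is invariant under inversion,
which makes the twisted involution isometric.

A regular Haar measure need not be `σ`-finite, so Fubini's theorem is not available for arbitrary
integrable functions. It does hold for continuous functions with compact support. Every integrable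
function is almost everywhere the sum of a series of such functions whose norms in `L¹` have a sum
arbitrarily close to the norm of the function; expanding both factors of a convolution into such
series gives the almost everywhere absolute convergence of the convolution integral, the
measurability of the convolution and the estimate `‖F * H‖₁ ≤ ‖F‖₁ ‖H‖₁`. Associativity passes from
continuous functions with compact support to `L¹` by density.
-/

namespace HolonomyFlux

open scoped ENNReal NNReal Pointwise CompactlySupported

section Unimodularity

open Measure

section Product

variable {G H : Type*} [MeasurableSpace G] [MeasurableSpace (G × H)]

/-- The slice `A ↦ ν (A ×ˢ C)` of a measure on a product over a set `C` of second coordinates. The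
`σ`-algebra of the product need not be the product `σ`-algebra. -/
noncomputable def sliceMeasure (ν : Measure (G × H)) (C : Set H) : Measure G :=
  (ν.restrict (Prod.snd ⁻¹' C)).map Prod.fst

theorem sliceMeasure_smul (c : ℝ≥0) (ν : Measure (G × H)) (C : Set H) :
    sliceMeasure (c • ν) C = c • sliceMeasure ν C := by
  rw [sliceMeasure, sliceMeasure, restrict_smul, Measure.map_smul]

variable [TopologicalSpace G] [BorelSpace G] [TopologicalSpace H] [BorelSpace (G × H)]

theorem sliceMeasure_apply (ν : Measure (G × H)) (C : Set H) {A : Set G} (hA : MeasurableSet A) :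
    sliceMeasure ν C A = ν (A ×ˢ C) := by
  rw [sliceMeasure, map_apply continuous_fst.measurable hA,
    restrict_apply (continuous_fst.measurable hA), Set.prod_eq]

theorem sliceMeasure_map_prodMap_id (ν : Measure (G × H)) {C : Set H} (hC : IsClosed C) {φ : G → G}
    (hφ : Continuous φ) :
    sliceMeasure (ν.map (Prod.map φ id)) C = (sliceMeasure ν C).map φ := by
  have hφ' : Measurable (Prod.map φ id : G × H → G × H) := (hφ.prodMap continuous_id).measurable
  rw [sliceMeasure, sliceMeasure, restrict_map hφ' (hC.preimage continuous_snd).measurableSet,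
    map_map continuous_fst.measurable hφ', map_map hφ.measurable continuous_fst.measurable]
  rfl

variable [Group G] [IsTopologicalGroup G] [Group H]

theorem isHaarMeasure_sliceMeasure (ν : Measure (G × H)) [ν.IsHaarMeasure] {C : Set H}
    (hC : IsCompact C) (hC_closed : IsClosed C) (hC_nhds : C ∈ 𝓝 1) :
    (sliceMeasure ν C).IsHaarMeasure where
  lt_top_of_isCompact A hA :=
    calc sliceMeasure ν C A
      _ ≤ sliceMeasure ν C (closure A) := measure_mono subset_closure
      _ = ν (closure A ×ˢ C) := sliceMeasure_apply ν C isClosed_closure.measurableSet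
      _ < ∞ := (hA.closure.prod hC).measure_lt_top
  map_mul_left_eq_self g := by
    rw [← sliceMeasure_map_prodMap_id ν hC_closed (continuous_const_mul g)]
    conv_rhs => rw [← map_mul_left_eq_self ν (g, 1)]
    congr 2
    ext x <;> simp
  open_pos U hU hU_nonempty := by
    rw [sliceMeasure_apply ν C hU.measurableSet]
    refine (measure_pos_of_nonempty_interior ν ?_).ne'
    rw [interior_prod_eq, hU.interior_eq]
    exact hU_nonempty.prod ⟨1, mem_interior_iff_mem_nhds.2 hC_nhds⟩

end Product

variable {G H : Type*} [Group G] [TopologicalSpace G] [IsTopologicalGroup G] [LocallyCompactSpace G]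
  [Group H] [TopologicalSpace H] [IsTopologicalGroup H] [LocallyCompactSpace H]

theorem map_mul_right_eq_modularCharacter_smul [MeasurableSpace G] [BorelSpace G]
    (μ : Measure G) [μ.IsHaarMeasure] [μ.Regular] (g : G) :
    μ.map (· * g) = modularCharacter g • μ := by
  have : Regular (μ.map (· * g)) := Regular.map (Homeomorph.mulRight g)
  rw [isMulLeftInvariant_eq_smul_of_regular (μ.map (· * g)) μ,
    ← modularCharacterFun_eq_haarScalarFactor μ g]
  rfl

theorem eq_modularCharacter_of_map_mul_right [MeasurableSpace G] [BorelSpace G] (μ : Measure G)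
    [μ.IsHaarMeasure] {g : G} {c : ℝ≥0} (h : μ.map (· * g) = c • μ) : modularCharacter g = c := by
  change modularCharacterFun g = c
  simp only [modularCharacterFun_eq_haarScalarFactor μ, h, haarScalarFactor_smul,
    haarScalarFactor_self, smul_eq_mul, mul_one]

theorem modularCharacter_map (e : G ≃ₜ* H) (g : G) :
    modularCharacter (e g) = modularCharacter g := by
  borelize G H
  let μ : Measure G := haar
  have he : Measurable e := e.continuous.measurable
  have : (μ.map e).IsHaarMeasure := e.isHaarMeasure_map μ
  refine eq_modularCharacter_of_map_mul_right (μ.map e) ?_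
  rw [← Measure.map_smul, ← map_mul_right_eq_modularCharacter_smul μ g,
    map_map (measurable_mul_const _) he, map_map he (measurable_mul_const _)]
  congr 1
  ext x
  simp

theorem modularCharacter_prodMk_one (g : G) :
    modularCharacter (g, (1 : H)) = modularCharacter g := by
  borelize G (G × H)
  obtain ⟨C, hC_nhds, hC, hC_closed⟩ := exists_mem_nhds_isCompact_isClosed (1 : H)
  let ν : Measure (G × H) := haar
  have := isHaarMeasure_sliceMeasure ν hC hC_closed hC_nhds
  refine (eq_modularCharacter_of_map_mul_right (sliceMeasure ν C) ?_).symm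
  rw [← sliceMeasure_smul, ← map_mul_right_eq_modularCharacter_smul ν,
    ← sliceMeasure_map_prodMap_id ν hC_closed (continuous_mul_const g)]
  congr 2
  ext x <;> simp

theorem modularCharacter_pi_mulSingle {ι : Type*} [DecidableEq ι] [Finite ι]
    {G : ι → Type*} [∀ i, Group (G i)] [∀ i, TopologicalSpace (G i)]
    [∀ i, IsTopologicalGroup (G i)] [∀ i, LocallyCompactSpace (G i)] (i : ι) (g : G i) :
    modularCharacter (Pi.mulSingle i g) = modularCharacter g := by
  let e : (∀ j, G j) ≃ₜ* G i × ∀ j : {j // j ≠ i}, G j :=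
    { Homeomorph.piSplitAt i G with map_mul' := fun _ _ => rfl }
  have he : e (Pi.mulSingle i g) = (g, 1) :=
    Prod.ext (Pi.mulSingle_eq_same i g) (funext fun j => Pi.mulSingle_eq_of_ne j.2 g)
  rw [← modularCharacter_map e, he, modularCharacter_prodMk_one]

theorem modularCharacter_pi {ι : Type*} [Fintype ι] {G : ι → Type*} [∀ i, Group (G i)]
    [∀ i, TopologicalSpace (G i)] [∀ i, IsTopologicalGroup (G i)] [∀ i, LocallyCompactSpace (G i)]
    (x : ∀ i, G i) : modularCharacter x = ∏ i, modularCharacter (x i) := by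
  classical
  have h : (modularCharacter : (∀ i, G i) →* ℝ≥0) =
      ∏ i, (modularCharacter : G i →* ℝ≥0).comp (Pi.evalMonoidHom G i) := by
    refine MonoidHom.pi_ext fun i g => ?_
    rw [modularCharacter_pi_mulSingle, MonoidHom.finsetProd_apply, Fintype.prod_eq_single i]
    · simp
    · intro j hj
      simp [Pi.mulSingle_eq_of_ne hj]
  rw [h, MonoidHom.finsetProd_apply]
  rfl

theorem isMulRightInvariant_of_modularCharacter_eq_one [MeasurableSpace G] [BorelSpace G]
    (μ : Measure G) [μ.IsHaarMeasure] [μ.Regular] (hG : ∀ g : G, modularCharacter g = 1) :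
    μ.IsMulRightInvariant :=
  ⟨fun g => by rw [map_mul_right_eq_modularCharacter_smul, hG, one_smul]⟩

theorem isInvInvariant_of_isMulRightInvariant [MeasurableSpace G] [BorelSpace G]
    (μ : Measure G) [μ.IsHaarMeasure] [μ.Regular] [μ.IsMulRightInvariant] : μ.IsInvInvariant := by
  have : Regular μ.inv := Regular.map (Homeomorph.inv G)
  have h_inv : μ.inv = haarScalarFactor μ.inv μ • μ :=
    isMulLeftInvariant_eq_smul_of_regular μ.inv μ
  -- The scalar is determined by the measure of any symmetric compact neighbourhood of `1`.
  obtain ⟨C, hC_nhds, hC, -⟩ := exists_mem_nhds_isCompact_isClosed (1 : G)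
  have hC_pos : μ (C ∪ C⁻¹) ≠ 0 :=
    (measure_pos_of_mem_nhds μ (mem_of_superset hC_nhds Set.subset_union_left)).ne'
  have hC_top : μ (C ∪ C⁻¹) ≠ ∞ := (hC.union hC.inv).measure_ne_top
  have hC_inv : haarScalarFactor μ.inv μ * μ (C ∪ C⁻¹) = 1 * μ (C ∪ C⁻¹) :=
    calc haarScalarFactor μ.inv μ * μ (C ∪ C⁻¹)
      _ = μ.inv (C ∪ C⁻¹) := (DFunLike.congr_fun h_inv (C ∪ C⁻¹)).symm
      _ = 1 * μ (C ∪ C⁻¹) := by rw [inv_apply, Set.union_inv, inv_inv, Set.union_comm, one_mul]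
  refine ⟨h_inv.trans ?_⟩
  rw [ENNReal.coe_eq_one.1 ((ENNReal.mul_left_inj hC_pos hC_top).1 hC_inv), one_smul]

end Unimodularity

section FluxAction

variable {M : Type u} [TopologicalSpace M] {N : ℕ} {Γ : Graph M N}
  {S : Fin N → OrientedSurface M}

theorem iotaL_eq_zero (hS : SimpleSurfaceIntersectionProperty Γ S) (i j : Fin N) :
    iotaL (S j) (Γ.edge i) = 0 := by
  have h_source : (Γ.edge i).source ∉ (S j).carrier := fun h =>
    zero_ne_one ((hS.mem_iff i j 0).1 h).2
  simp [iotaL, OutgoingIn, h_source]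

theorem iotaR_eq (hS : SimpleSurfaceIntersectionProperty Γ S) (i j : Fin N) :
    iotaR (S j) (Γ.edge i) = if i = j then -1 else 0 := by
  split_ifs with hij
  · subst hij
    exact if_pos (hS.lies_above i)
  · have h_target : (Γ.edge i).target ∉ (S j).carrier := fun h => hij ((hS.mem_iff i j 1).1 h).1
    simp [iotaR, IngoingIn, h_target]

variable {G : Type v} [Group G]

theorem fst_eq_one_of_mem_fluxImages (hS : SimpleSurfaceIntersectionProperty Γ S)
    {x : Fin N → G × G} (hx : x ∈ fluxImages G Γ S) (i : Fin N) : (x i).1 = 1 := by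
  obtain ⟨oL, oR, j, h⟩ := hx
  rw [h i, iotaL_eq_zero hS, zpow_zero]

theorem mulSingle_mem_fluxImages (hS : SimpleSurfaceIntersectionProperty Γ S) (j : Fin N) (g : G) :
    Pi.mulSingle j (1, g) ∈ fluxImages G Γ S := by
  refine ⟨1, fun _ => g⁻¹, j, fun i => ?_⟩
  rw [iotaL_eq_zero hS, iotaR_eq hS]
  obtain rfl | hij := eq_or_ne i j
  · simp
  · simp [hij, Prod.one_eq_mk]

theorem mem_fluxGroup_iff (hS : SimpleSurfaceIntersectionProperty Γ S) (x : Fin N → G × G) :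
    x ∈ fluxGroup G Γ S ↔ ∀ i, (x i).1 = 1 := by
  constructor
  · intro hx
    change x ∈ Submonoid.closure (fluxImages G Γ S) at hx
    induction hx using Submonoid.closure_induction with
    | mem x hx => exact fst_eq_one_of_mem_fluxImages hS hx
    | one => exact fun _ => rfl
    | mul x y _ _ hx hy =>
      intro i
      rw [Pi.mul_apply, Prod.fst_mul, hx i, hy i, one_mul]
  · intro hx
    refine Subgroup.pi_mem_of_mulSingle_mem x fun j => Submonoid.subset_closure ?_
    rw [← Prod.mk.eta (p := x j), hx j]
    exact mulSingle_mem_fluxImages hS j (x j).2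

variable [TopologicalSpace G]

theorem continuous_ingoingFlux {J : Type} {S : J → OrientedSurface M} :
    Continuous (ingoingFlux : fluxGroup G Γ S → Fin N → G) :=
  continuous_pi fun i => ((continuous_apply i).comp continuous_subtype_val).snd

/-- Under the simple surface intersection property the flux group is `G ^ N`. -/
def ingoingFluxEquiv (G : Type v) [Group G] [TopologicalSpace G]
    (hS : SimpleSurfaceIntersectionProperty Γ S) : fluxGroup G Γ S ≃ₜ* (Fin N → G) where
  toFun := ingoingFlux
  invFun y := ⟨fun i => (1, y i), (mem_fluxGroup_iff hS _).2 fun _ => rfl⟩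
  left_inv ρ := Subtype.ext <| funext fun i =>
    Prod.ext ((mem_fluxGroup_iff hS ρ.1).1 ρ.2 i).symm rfl
  right_inv _ := rfl
  map_mul' _ _ := rfl
  continuous_toFun := continuous_ingoingFlux
  continuous_invFun := by fun_prop

theorem continuous_leftAction_apply {J : Type} {S : J → OrientedSurface M}
    [IsTopologicalGroup G] (f : C₀(configSpace G Γ, ℂ)) :
    Continuous fun ρ : fluxGroup G Γ S => leftAction Γ S ρ f := by
  refine continuous_iff_continuousAt.2 fun ρ₀ => ?_
  have h_one : Tendsto (fun ρ : fluxGroup G Γ S => (ingoingFlux ρ)⁻¹ * ingoingFlux ρ₀) (𝓝 ρ₀)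
      (𝓝 1) :=
    (continuous_ingoingFlux.inv.mul continuous_const).tendsto' ρ₀ 1 (inv_mul_cancel _)
  let : UniformSpace (Fin N → G) := IsTopologicalGroup.rightUniformSpace _
  have h_translation : TendstoUniformly
      (fun (ρ : fluxGroup G Γ S) x => leftTranslation Γ (ingoingFlux ρ)⁻¹ x)
      (leftTranslation Γ (ingoingFlux ρ₀)⁻¹) (𝓝 ρ₀) := by
    rw [tendstoUniformly_iff_tendsto, uniformity_subtype, uniformity_eq_comap_nhds_one',
      comap_comap, tendsto_comap_iff]
    refine (h_one.comp tendsto_fst).congr fun q => ?_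
    simp [leftTranslation, mul_assoc]
  exact ZeroAtInftyContinuousMap.tendsto_iff_tendstoUniformly.2
    ((ZeroAtInftyContinuousMap.uniformContinuous f).comp_tendstoUniformly h_translation)

end FluxAction

section Approximation

variable {X E : Type*} [MeasurableSpace X] {μ : Measure X} [NormedAddCommGroup E]

theorem ae_hasSum_sub_of_tsum_eLpNorm_ne_top {F : X → E} {g : ℕ → X → E} (hg_zero : g 0 = 0)
    (hF : AEStronglyMeasurable F μ) (hg : ∀ n, AEStronglyMeasurable (g n) μ)
    (hFg : ∑' n, eLpNorm (fun x => F x - g (n + 1) x) 1 μ ≠ ∞)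
    (h_sub : ∑' n, eLpNorm (fun x => g (n + 1) x - g n x) 1 μ ≠ ∞) :
    ∀ᵐ x ∂μ, HasSum (fun n => g (n + 1) x - g n x) (F x) := by
  filter_upwards [
    summable_norm_of_tsum_eLpNorm_ne_top le_rfl (fun n => hF.sub (hg (n + 1))) hFg,
    summable_norm_of_tsum_eLpNorm_ne_top le_rfl (fun n => (hg (n + 1)).sub (hg n)) h_sub]
    with x h_tendsto h_summable
  refine (hasSum_iff_tendsto_nat_of_summable_norm h_summable).2 ?_
  have h_zero : Tendsto (fun n => g (n + 1) x - F x) atTop (𝓝 0) :=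
    tendsto_zero_iff_norm_tendsto_zero.2
      (h_tendsto.tendsto_atTop_zero.congr fun n => norm_sub_rev _ _)
  refine ((tendsto_add_atTop_iff_nat (f := fun n => g n x) 1).1
    (tendsto_sub_nhds_zero_iff.1 h_zero)).congr fun n => ?_
  refine ((Finset.sum_range_sub (fun n => g n x) n).trans ?_).symm
  rw [hg_zero, Pi.zero_apply, sub_zero]

variable [TopologicalSpace X] [BorelSpace X]

theorem integrable_compactlySupported [IsFiniteMeasureOnCompacts μ] (g : C_c(X, E)) :
    Integrable g μ :=
  (map_continuous g).integrable_of_hasCompactSupport g.hasCompactSupport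

theorem ae_summable_norm_of_tsum_lintegral_ne_top [IsFiniteMeasureOnCompacts μ] {ι : Type*}
    [Countable ι] {u : ι → C_c(X, E)} (hu : ∑' i, ∫⁻ x, ‖u i x‖ₑ ∂μ ≠ ∞) :
    ∀ᵐ x ∂μ, Summable fun i => ‖u i x‖ :=
  summable_norm_of_tsum_eLpNorm_ne_top le_rfl
    (fun i => (integrable_compactlySupported (u i)).aestronglyMeasurable) <| by
      simpa only [eLpNorm_one_eq_lintegral_enorm] using hu

variable [R1Space X] [LocallyCompactSpace X] [μ.Regular] [NormedSpace ℝ E]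

theorem exists_hasCompactSupport_eLpNorm_sub_indicator_le {p : ℝ≥0∞} (hp : p ≠ ∞) (c : E)
    {t : Set X} (ht : MeasurableSet t) (hμt : μ t ≠ ∞) {ε : ℝ≥0∞} (hε : ε ≠ 0) :
    ∃ g : X → E, eLpNorm (g - t.indicator fun _ => c) p μ ≤ ε ∧
      Continuous g ∧ HasCompactSupport g := by
  obtain ⟨η, hη, hηε⟩ := exists_eLpNorm_indicator_le (μ := μ) hp c hε
  have hη_half : (η : ℝ≥0∞) / 2 ≠ 0 := (ENNReal.half_pos (ENNReal.coe_pos.2 hη).ne').ne'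
  obtain ⟨s, hst, hs, -, hμs⟩ := ht.exists_isCompact_isClosed_sdiff_lt hμt hη_half
  obtain ⟨U, htU, hU, -, hμU⟩ := ht.exists_isOpen_sdiff_lt hμt hη_half
  -- Urysohn's lemma for a compact set does without the normality of `X` that
  -- `MemLp.exists_hasCompactSupport_eLpNorm_sub_le` assumes.
  obtain ⟨f, hfs, hfU, hf_supp, hf⟩ := exists_continuous_one_zero_of_isCompact hs
    hU.isClosed_compl (Set.disjoint_compl_right_iff_subset.2 (hst.trans htU))
  refine ⟨fun x => f x • c, ?_, by fun_prop, hf_supp.smul_right⟩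
  have h_le : ∀ r ∈ Set.Icc (0 : ℝ) 1, ‖r • c‖ ≤ ‖c‖ := fun r hr => by
    rw [norm_smul, Real.norm_of_nonneg hr.1]
    exact mul_le_of_le_one_left (norm_nonneg c) hr.2
  refine (eLpNorm_mono fun x => ?_).trans (hηε (U \ s) ?_)
  · by_cases hxs : x ∈ s
    · simp [hfs hxs, hst hxs, hxs]
    by_cases hxU : x ∈ U
    · by_cases hxt : x ∈ t
      · have h := h_le (1 - f x) ⟨sub_nonneg.2 (hf x).2, sub_le_self 1 (hf x).1⟩
        rw [sub_smul, one_smul, norm_sub_rev] at h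
        simpa [hxs, hxU, hxt] using h
      · simpa [hxs, hxU, hxt] using h_le _ (hf x)
    · have hxt : x ∉ t := fun h => hxU (htU h)
      simp [hfU hxU, hxt]
  · calc μ (U \ s)
      _ ≤ μ (U \ t ∪ t \ s) := measure_mono fun x hx =>
          (em (x ∈ t)).elim (fun hxt => Or.inr ⟨hxt, hx.2⟩) fun hxt => Or.inl ⟨hx.1, hxt⟩
      _ ≤ η / 2 + η / 2 := (measure_union_le _ _).trans (add_le_add hμU.le hμs.le)
      _ = η := ENNReal.add_halves _

theorem exists_compactlySupported_eLpNorm_sub_le {p : ℝ≥0∞} (hp : p ≠ ∞) {F : X → E}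
    (hF : MemLp F p μ) {ε : ℝ≥0∞} (hε : ε ≠ 0) :
    ∃ g : C_c(X, E), eLpNorm (fun x => F x - g x) p μ ≤ ε := by
  have h_add (f g : X → E) (hf : Continuous f ∧ HasCompactSupport f)
      (hg : Continuous g ∧ HasCompactSupport g) : Continuous (f + g) ∧ HasCompactSupport (f + g) :=
    ⟨hf.1.add hg.1, hf.2.add hg.2⟩
  obtain ⟨g, hg, hg_cont, hg_supp⟩ := hF.induction_dense hp
    (fun g => Continuous g ∧ HasCompactSupport g)
    (fun c _ ht hμt _ hε => exists_hasCompactSupport_eLpNorm_sub_indicator_le hp c ht hμt.ne hε)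
    h_add (fun _ hf => (hf.1.integrable_of_hasCompactSupport hf.2).aestronglyMeasurable) hε
  exact ⟨⟨⟨g, hg_cont⟩, hg_supp⟩, hg⟩

theorem exists_ae_hasSum_compactlySupported {F : X → E} (hF : Integrable F μ) {r : ℝ≥0∞}
    (hr : ∫⁻ x, ‖F x‖ₑ ∂μ < r) :
    ∃ u : ℕ → C_c(X, E), ∑' n, ∫⁻ x, ‖u n x‖ₑ ∂μ < r ∧
      ∀ᵐ x ∂μ, HasSum (fun n => u n x) (F x) := by
  simp only [← eLpNorm_one_eq_lintegral_enorm] at hr ⊢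
  obtain ⟨δ, hδ_pos, hδ⟩ := ENNReal.exists_pos_sum_of_countable'
    (ENNReal.half_pos (tsub_pos_of_lt hr).ne').ne' ℕ
  choose g' hg' using fun n => exists_compactlySupported_eLpNorm_sub_le ENNReal.one_ne_top
    (memLp_one_iff_integrable.2 hF) (hδ_pos n).ne'
  let g : ℕ → C_c(X, E) := fun n => n.casesOn 0 g'
  let e : ℕ → ℝ≥0∞ := fun n => eLpNorm (fun x => F x - g n x) 1 μ
  have he : ∑' n, e (n + 1) ≤ ∑' n, δ n := ENNReal.tsum_le_tsum hg'
  have hu_le : ∀ n, eLpNorm (g (n + 1) - g n : C_c(X, E)) 1 μ ≤ e n + e (n + 1) := fun n => by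
    have h := eLpNorm_sub_le (hF.sub (integrable_compactlySupported (g n))).aestronglyMeasurable
      (hF.sub (integrable_compactlySupported (g (n + 1)))).aestronglyMeasurable le_rfl
    refine le_trans (le_of_eq ?_) h
    congr 1
    ext x
    simp
  have hu : ∑' n, eLpNorm (g (n + 1) - g n : C_c(X, E)) 1 μ < r :=
    calc ∑' n, eLpNorm (g (n + 1) - g n : C_c(X, E)) 1 μ
      _ ≤ ∑' n, (e n + e (n + 1)) := ENNReal.tsum_le_tsum hu_le
      _ = e 0 + (∑' n, e (n + 1) + ∑' n, e (n + 1)) := by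
        rw [ENNReal.tsum_add, tsum_eq_zero_add' ENNReal.summable, add_assoc]
      _ < eLpNorm F 1 μ + (r - eLpNorm F 1 μ) := by
        have h0 : e 0 = eLpNorm F 1 μ := by simp [e, g]
        rw [h0, ← ENNReal.add_halves (r - _)]
        have h1 := he.trans_lt hδ
        exact ENNReal.add_lt_add_left (memLp_one_iff_integrable.2 hF).eLpNorm_ne_top
          (ENNReal.add_lt_add h1 h1)
      _ = r := add_tsub_cancel_of_le hr.le
  exact ⟨fun n => g (n + 1) - g n, hu, ae_hasSum_sub_of_tsum_eLpNorm_ne_top (g := fun n => g n) rfl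
    hF.aestronglyMeasurable
    (fun n => (integrable_compactlySupported (g n)).aestronglyMeasurable)
    (he.trans_lt hδ.lt_top).ne hu.ne_top⟩

end Approximation

section SeriesOfFunctions

theorem hasSum_mul_of_summable_norm {R ι κ : Type*} [NonUnitalNormedRing R] [CompleteSpace R]
    {f : ι → R} {g : κ → R} {a b : R} (hf : HasSum f a) (hg : HasSum g b)
    (hf_norm : Summable fun i => ‖f i‖) (hg_norm : Summable fun j => ‖g j‖) :
    HasSum (fun p : ι × κ => f p.1 * g p.2) (a * b) :=
  hf.mul hg <| .of_norm_bounded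
    (hf_norm.mul_of_nonneg hg_norm (fun _ => norm_nonneg _) fun _ => norm_nonneg _)
    fun _ => norm_mul_le _ _

variable {X E ι : Type*} [MeasurableSpace X] {μ : Measure X} [NormedAddCommGroup E] [Countable ι]
  {f : ι → X → E} {F : X → E}

theorem lintegral_enorm_le_tsum_of_ae_hasSum (hf : ∀ i, AEStronglyMeasurable (f i) μ)
    (hF : ∀ᵐ x ∂μ, HasSum (fun i => f i x) (F x)) :
    ∫⁻ x, ‖F x‖ₑ ∂μ ≤ ∑' i, ∫⁻ x, ‖f i x‖ₑ ∂μ :=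
  calc ∫⁻ x, ‖F x‖ₑ ∂μ
    _ ≤ ∫⁻ x, ∑' i, ‖f i x‖ₑ ∂μ := lintegral_mono_ae <| hF.mono fun _ hx =>
      hx.tsum_eq ▸ enorm_tsum_le_tsum_enorm
    _ = ∑' i, ∫⁻ x, ‖f i x‖ₑ ∂μ := lintegral_tsum fun i => (hf i).enorm

theorem integrable_of_ae_hasSum (hf : ∀ i, AEStronglyMeasurable (f i) μ)
    (hf_sum : ∑' i, ∫⁻ x, ‖f i x‖ₑ ∂μ ≠ ∞) (hF : ∀ᵐ x ∂μ, HasSum (fun i => f i x) (F x)) :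
    Integrable F μ := by
  refine ⟨aestronglyMeasurable_of_tendsto_ae atTop (fun s => ?_) hF,
    (lintegral_enorm_le_tsum_of_ae_hasSum hf hF).trans_lt hf_sum.lt_top⟩
  exact Finset.aestronglyMeasurable_fun_sum s fun i _ => hf i

theorem hasSum_integral_of_ae_hasSum [NormedSpace ℝ E] (hf : ∀ i, AEStronglyMeasurable (f i) μ)
    (hf_sum : ∑' i, ∫⁻ x, ‖f i x‖ₑ ∂μ ≠ ∞) (hF : ∀ᵐ x ∂μ, HasSum (fun i => f i x) (F x)) :
    HasSum (fun i => ∫ x, f i x ∂μ) (∫ x, F x ∂μ) := by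
  rw [← integral_congr_ae (hF.mono fun _ hx => hx.tsum_eq)]
  refine hasSum_integral_of_summable_integral_norm
    (fun i => ⟨hf i, (ENNReal.ne_top_of_tsum_ne_top hf_sum i).lt_top⟩) ?_
  simpa only [integral_norm_eq_lintegral_enorm (hf _)] using ENNReal.summable_toReal hf_sum

end SeriesOfFunctions

section IteratedIntegral

variable {X Y E : Type*} [TopologicalSpace X] [TopologicalSpace Y] [NormedAddCommGroup E]
  {f : X → Y → E}

theorem hasCompactSupport_of_uncurry [R1Space Y] (hf : HasCompactSupport f.uncurry) (x : X) :
    HasCompactSupport (f x) :=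
  .intro (hf.isCompact.image continuous_snd) fun y hy => by_contra fun h_ne =>
    hy ⟨(x, y), subset_tsupport f.uncurry h_ne, rfl⟩

variable [MeasurableSpace Y] {ν : Measure Y}

theorem hasCompactSupport_integral_of_uncurry [R1Space X] [NormedSpace ℝ E]
    (hf : HasCompactSupport f.uncurry) : HasCompactSupport fun x => ∫ y, f x y ∂ν :=
  .intro (hf.isCompact.image continuous_fst) fun x hx =>
    integral_eq_zero_of_ae <| .of_forall fun y => by_contra fun h_ne =>
      hx ⟨(x, y), subset_tsupport f.uncurry h_ne, rfl⟩

variable [BorelSpace Y] [IsFiniteMeasureOnCompacts ν]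

theorem continuous_integral_of_hasCompactSupport [NormedSpace ℝ E]
    (hf_cont : Continuous f.uncurry) (hf : HasCompactSupport f.uncurry) :
    Continuous fun x => ∫ y, f x y ∂ν :=
  continuousOn_univ.1 <| continuousOn_integral_of_compact_support
    (hf.isCompact.image continuous_snd) hf_cont.continuousOn fun x y _ hy =>
      by_contra fun h_ne => hy ⟨(x, y), subset_tsupport f.uncurry h_ne, rfl⟩

theorem integrable_of_hasCompactSupport_uncurry [R1Space Y] (hf_cont : Continuous f.uncurry)
    (hf : HasCompactSupport f.uncurry) (x : X) : Integrable (f x) ν :=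
  (hf_cont.comp (.prodMk_right x)).integrable_of_hasCompactSupport
    (hasCompactSupport_of_uncurry hf x)

variable [R1Space Y] [MeasurableSpace X] [BorelSpace X]

theorem measurable_lintegral_enorm_of_hasCompactSupport (hf_cont : Continuous f.uncurry)
    (hf : HasCompactSupport f.uncurry) : Measurable fun x => ∫⁻ y, ‖f x y‖ₑ ∂ν := by
  simp only [← ofReal_integral_norm_eq_lintegral_enorm
    (integrable_of_hasCompactSupport_uncurry hf_cont hf _)]
  exact (continuous_integral_of_hasCompactSupport (f := fun x y => ‖f x y‖) hf_cont.norm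
    hf.norm).measurable.ennreal_ofReal

variable [R1Space X] {μ : Measure X}

theorem lintegral_lintegral_enorm_eq_ofReal_of_hasCompactSupport [IsFiniteMeasureOnCompacts μ]
    (hf_cont : Continuous f.uncurry) (hf : HasCompactSupport f.uncurry) :
    ∫⁻ x, ∫⁻ y, ‖f x y‖ₑ ∂ν ∂μ = ENNReal.ofReal (∫ x, ∫ y, ‖f x y‖ ∂ν ∂μ) := by
  simp only [← ofReal_integral_norm_eq_lintegral_enorm
    (integrable_of_hasCompactSupport_uncurry hf_cont hf _)]
  refine (ofReal_integral_eq_lintegral_ofReal ?_ <| .of_forall fun x =>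
    integral_nonneg fun y => norm_nonneg _).symm
  exact (continuous_integral_of_hasCompactSupport (f := fun x y => ‖f x y‖) hf_cont.norm
    hf.norm).integrable_of_hasCompactSupport
    (hasCompactSupport_integral_of_uncurry (f := fun x y => ‖f x y‖) hf.norm)

theorem lintegral_lintegral_enorm_swap_of_hasCompactSupport [IsFiniteMeasureOnCompacts μ]
    (hf_cont : Continuous f.uncurry) (hf : HasCompactSupport f.uncurry) :
    ∫⁻ x, ∫⁻ y, ‖f x y‖ₑ ∂ν ∂μ = ∫⁻ y, ∫⁻ x, ‖f x y‖ₑ ∂μ ∂ν := by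
  rw [lintegral_lintegral_enorm_eq_ofReal_of_hasCompactSupport hf_cont hf,
    lintegral_lintegral_enorm_eq_ofReal_of_hasCompactSupport (f := fun y x => f x y)
      (hf_cont.comp continuous_swap) (hf.comp_homeomorph (Homeomorph.prodComm Y X)),
    integral_integral_swap_of_hasCompactSupport (f := fun x y => ‖f x y‖) hf_cont.norm hf.norm]

end IteratedIntegral

section Convolution

variable {K : Type*} [Group K] [TopologicalSpace K] [IsTopologicalGroup K]

theorem hasCompactSupport_uncurry_conv {E E' E'' : Type*} [Zero E] [Zero E'] [Zero E'']
    {u : K → E} {v : K → E'} (hu : HasCompactSupport u) (hv : HasCompactSupport v)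
    {f : K → K → E''} (hf : ∀ τ ρ, f τ ρ ≠ 0 → u ρ ≠ 0 ∧ v (ρ⁻¹ * τ) ≠ 0) :
    HasCompactSupport f.uncurry := by
  refine .intro ((hu.isCompact.mul hv.isCompact).prod hu.isCompact) fun ⟨τ, ρ⟩ h => ?_
  by_contra h_ne
  obtain ⟨hu_ne, hv_ne⟩ := hf τ ρ h_ne
  have hρ : ρ ∈ tsupport u := subset_tsupport u hu_ne
  exact h ⟨⟨ρ, hρ, ρ⁻¹ * τ, subset_tsupport v hv_ne, mul_inv_cancel_left ρ τ⟩, hρ⟩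

variable {E E' : Type*} [NormedAddCommGroup E] [NormedAddCommGroup E'] (u : C_c(K, E))
  (v : C_c(K, E'))

theorem continuous_uncurry_norm_conv :
    Continuous (Function.uncurry fun τ ρ => ‖u ρ‖ * ‖v (ρ⁻¹ * τ)‖) := by
  have hu := map_continuous u
  have hv := map_continuous v
  simp only [Function.uncurry_def]
  fun_prop

theorem hasCompactSupport_uncurry_norm_conv :
    HasCompactSupport (Function.uncurry fun τ ρ => ‖u ρ‖ * ‖v (ρ⁻¹ * τ)‖) :=
  hasCompactSupport_uncurry_conv u.hasCompactSupport v.hasCompactSupport fun _ _ h =>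
    ⟨norm_ne_zero_iff.1 (left_ne_zero_of_mul h), norm_ne_zero_iff.1 (right_ne_zero_of_mul h)⟩

variable [MeasurableSpace K] [BorelSpace K] {μ : Measure K}

theorem measurePreserving_inv_mul [μ.IsMulLeftInvariant] [μ.IsInvInvariant] (τ : K) :
    MeasurePreserving (fun ρ => ρ⁻¹ * τ) μ μ := by
  simpa only [mul_inv_rev, inv_inv] using Measure.measurePreserving_mul_right_inv μ τ⁻¹

theorem measurable_lintegral_enorm_conv [IsFiniteMeasureOnCompacts μ] :
    Measurable fun τ => ∫⁻ ρ, ‖u ρ‖ₑ * ‖v (ρ⁻¹ * τ)‖ₑ ∂μ := by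
  simpa only [enorm_mul, enorm_norm] using measurable_lintegral_enorm_of_hasCompactSupport (ν := μ)
    (continuous_uncurry_norm_conv u v) (hasCompactSupport_uncurry_norm_conv u v)

theorem lintegral_lintegral_enorm_conv [μ.IsHaarMeasure] :
    ∫⁻ τ, ∫⁻ ρ, ‖u ρ‖ₑ * ‖v (ρ⁻¹ * τ)‖ₑ ∂μ ∂μ = (∫⁻ ρ, ‖u ρ‖ₑ ∂μ) * ∫⁻ ρ, ‖v ρ‖ₑ ∂μ := by
  have h_swap := lintegral_lintegral_enorm_swap_of_hasCompactSupport (μ := μ) (ν := μ)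
    (continuous_uncurry_norm_conv u v) (hasCompactSupport_uncurry_norm_conv u v)
  simp only [enorm_mul, enorm_norm] at h_swap
  calc ∫⁻ τ, ∫⁻ ρ, ‖u ρ‖ₑ * ‖v (ρ⁻¹ * τ)‖ₑ ∂μ ∂μ
    _ = ∫⁻ ρ, ∫⁻ τ, ‖u ρ‖ₑ * ‖v (ρ⁻¹ * τ)‖ₑ ∂μ ∂μ := h_swap
    _ = ∫⁻ ρ, ‖u ρ‖ₑ * ∫⁻ τ, ‖v τ‖ₑ ∂μ ∂μ := lintegral_congr fun ρ => by
      rw [lintegral_const_mul' _ _ enorm_ne_top, lintegral_mul_left_eq_self (fun τ => ‖v τ‖ₑ)]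
    _ = (∫⁻ ρ, ‖u ρ‖ₑ ∂μ) * ∫⁻ ρ, ‖v ρ‖ₑ ∂μ :=
      lintegral_mul_const _ (map_continuous u).enorm.measurable

end Convolution

section TwistedConvolution

variable {K : Type*} [Group K] {A : Type*} [NonUnitalCStarAlgebra A] {α : K →* (A ≃⋆ₐ[ℂ] A)}

theorem norm_action_apply (α : K →* (A ≃⋆ₐ[ℂ] A)) (ρ : K) (a : A) : ‖α ρ a‖ = ‖a‖ :=
  NonUnitalStarAlgHom.norm_map (α ρ) (α ρ).injective a

theorem enorm_action_apply (α : K →* (A ≃⋆ₐ[ℂ] A)) (ρ : K) (a : A) : ‖α ρ a‖ₑ = ‖a‖ₑ := by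
  rw [← ofReal_norm, norm_action_apply, ofReal_norm]

theorem enorm_mul_action_le (α : K →* (A ≃⋆ₐ[ℂ] A)) (ρ : K) (a b : A) :
    ‖a * α ρ b‖ₑ ≤ ‖a‖ₑ * ‖b‖ₑ := by
  rw [← enorm_action_apply α ρ b, ← ofReal_norm, ← ofReal_norm, ← ofReal_norm,
    ← ENNReal.ofReal_mul (norm_nonneg a)]
  exact ENNReal.ofReal_le_ofReal (norm_mul_le a _)

theorem action_mul_apply (α : K →* (A ≃⋆ₐ[ℂ] A)) (ρ τ : K) (a : A) :
    α (ρ * τ) a = α ρ (α τ a) :=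
  DFunLike.congr_fun (map_mul α ρ τ) a

/-- The action of a group element as a linear isometry, which commutes with integrals. -/
def actionIsometry (α : K →* (A ≃⋆ₐ[ℂ] A)) (ρ : K) : A →ₗᵢ[ℂ] A where
  toFun := α ρ
  map_add' := map_add (α ρ)
  map_smul' := map_smul (α ρ)
  norm_map' := norm_action_apply α ρ

theorem action_integral {X : Type*} [MeasurableSpace X] (α : K →* (A ≃⋆ₐ[ℂ] A)) (ρ : K)
    (μ : Measure X) (f : X → A) : α ρ (∫ x, f x ∂μ) = ∫ x, α ρ (f x) ∂μ :=
  ((actionIsometry α ρ).integral_comp_comm f).symm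

theorem star_integral {X : Type*} [MeasurableSpace X] (μ : Measure X) (f : X → A) :
    star (∫ x, f x ∂μ) = ∫ x, star (f x) ∂μ :=
  ((starL' ℝ : A ≃L[ℝ] A).integral_comp_comm f).symm

theorem enorm_twistedInvolution (F : K → A) (ρ : K) : ‖twistedInvolution α F ρ‖ₑ = ‖F ρ⁻¹‖ₑ := by
  rw [twistedInvolution, ← ofReal_norm, norm_action_apply, norm_star, ofReal_norm]

theorem twistedInvolution_twistedInvolution (F : K → A) :
    twistedInvolution α (twistedInvolution α F) = F := by
  ext ρ
  simp only [twistedInvolution, inv_inv]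
  rw [← map_star, star_star, ← action_mul_apply, mul_inv_cancel, map_one, StarAlgEquiv.one_apply]

theorem twistedInvolution_add (F H : K → A) :
    twistedInvolution α (F + H) = twistedInvolution α F + twistedInvolution α H := by
  ext ρ
  simp only [twistedInvolution, Pi.add_apply, star_add, map_add]

theorem twistedInvolution_smul (c : ℂ) (F : K → A) :
    twistedInvolution α (c • F) = star c • twistedInvolution α F := by
  ext ρ
  simp only [twistedInvolution, Pi.smul_apply, star_smul, map_smul]

section Measurable

variable [MeasurableSpace K] (μ : Measure K)

theorem twistedConvolution_smul_left (c : ℂ) (F H : K → A) :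
    twistedConvolution α μ (c • F) H = c • twistedConvolution α μ F H := by
  ext τ
  simp only [twistedConvolution, Pi.smul_apply, smul_mul_assoc, integral_smul]

theorem twistedConvolution_smul_right (c : ℂ) (F H : K → A) :
    twistedConvolution α μ F (c • H) = c • twistedConvolution α μ F H := by
  ext τ
  simp only [twistedConvolution, Pi.smul_apply, map_smul, mul_smul_comm, integral_smul]

theorem twistedInvolution_twistedConvolution [MeasurableMul K] [μ.IsMulLeftInvariant]
    (F H : K → A) :
    twistedInvolution α (twistedConvolution α μ F H) =
      twistedConvolution α μ (twistedInvolution α H) (twistedInvolution α F) := by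
  ext τ
  simp only [twistedInvolution, twistedConvolution]
  rw [star_integral, action_integral]
  conv_rhs => rw [← integral_mul_left_eq_self _ τ]
  refine integral_congr_ae (.of_forall fun ρ => ?_)
  have h_inv : ((τ * ρ)⁻¹ * τ)⁻¹ = ρ := by group
  have h_mul : τ * ρ * ((τ * ρ)⁻¹ * τ) = τ := by group
  simp only [← action_mul_apply, h_inv, h_mul]
  rw [star_mul, ← map_star, map_mul, ← action_mul_apply, mul_inv_rev]

end Measurable

section Continuity

variable [TopologicalSpace K] (hα : IsCStarDynamicalSystem α)
include hα

theorem continuous_uncurry_action : Continuous fun p : K × A => α p.1 p.2 := by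
  refine continuous_prod_of_continuous_lipschitzWith' _ 1 (fun ρ => ?_) hα.continuous_apply
  exact (actionIsometry α ρ).lipschitz

theorem continuous_action {X : Type*} [TopologicalSpace X] {f : X → K} {g : X → A}
    (hf : Continuous f) (hg : Continuous g) : Continuous fun x => α (f x) (g x) :=
  (continuous_uncurry_action hα).comp (hf.prodMk hg)

end Continuity

section CompactlySupported

variable [TopologicalSpace K] [IsTopologicalGroup K] (hα : IsCStarDynamicalSystem α)
  (F H L : C_c(K, A))

include hα in
theorem continuous_uncurry_twistedConvolution_integrand :
    Continuous (Function.uncurry fun τ ρ => F ρ * α ρ (H (ρ⁻¹ * τ))) :=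
  ((map_continuous F).comp continuous_snd).mul <| continuous_action hα continuous_snd <|
    (map_continuous H).comp (continuous_snd.inv.mul continuous_fst)

theorem hasCompactSupport_uncurry_twistedConvolution_integrand :
    HasCompactSupport (Function.uncurry fun τ ρ => F ρ * α ρ (H (ρ⁻¹ * τ))) :=
  hasCompactSupport_uncurry_conv F.hasCompactSupport H.hasCompactSupport fun τ ρ h =>
    ⟨left_ne_zero_of_mul h, fun h_zero => right_ne_zero_of_mul h <| by rw [h_zero, map_zero]⟩

variable [MeasurableSpace K] [BorelSpace K] (μ : Measure K)

include hα in
theorem integrable_twistedConvolution_integrand_compactlySupported [IsFiniteMeasureOnCompacts μ]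
    (τ : K) : Integrable (fun ρ => F ρ * α ρ (H (ρ⁻¹ * τ))) μ :=
  integrable_of_hasCompactSupport_uncurry
    (continuous_uncurry_twistedConvolution_integrand hα F H)
    (hasCompactSupport_uncurry_twistedConvolution_integrand F H) τ

/-- The twisted convolution as a product on the continuous functions with compact support, which
form a dense subspace of `L¹`. -/
noncomputable def compactlySupportedConvolution [IsFiniteMeasureOnCompacts μ] : C_c(K, A) where
  toFun := twistedConvolution α μ F H
  continuous_toFun := continuous_integral_of_hasCompactSupport
    (continuous_uncurry_twistedConvolution_integrand hα F H)
    (hasCompactSupport_uncurry_twistedConvolution_integrand F H)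
  hasCompactSupport' := hasCompactSupport_integral_of_uncurry
    (hasCompactSupport_uncurry_twistedConvolution_integrand F H)

variable [μ.IsHaarMeasure]

include hα in
theorem action_twistedConvolution_inv_mul (ρ τ : K) :
    F ρ * α ρ (twistedConvolution α μ H L (ρ⁻¹ * τ)) =
      ∫ σ, F ρ * α ρ (H (ρ⁻¹ * σ)) * α σ (L (σ⁻¹ * τ)) ∂μ := by
  have h_int : Integrable (fun σ => α ρ (H σ * α σ (L (σ⁻¹ * (ρ⁻¹ * τ))))) μ :=
    (actionIsometry α ρ).toContinuousLinearMap.integrable_comp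
      (integrable_twistedConvolution_integrand_compactlySupported hα H L μ (ρ⁻¹ * τ))
  rw [twistedConvolution, action_integral, ← integral_const_mul_of_integrable h_int]
  conv_rhs => rw [← integral_mul_left_eq_self _ ρ]
  simp only [map_mul (α ρ), mul_assoc, inv_mul_cancel_left, action_mul_apply, mul_inv_rev]

include hα in
theorem twistedConvolution_assoc_compactlySupported :
    twistedConvolution α μ (twistedConvolution α μ F H) L =
      twistedConvolution α μ F (twistedConvolution α μ H L) := by
  ext τ
  let Φ : K → K → A := fun σ ρ => F ρ * α ρ (H (ρ⁻¹ * σ)) * α σ (L (σ⁻¹ * τ))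
  have hΦ : Continuous Φ.uncurry :=
    (continuous_uncurry_twistedConvolution_integrand hα F H).mul <|
      continuous_action hα continuous_fst <|
        (map_continuous L).comp (continuous_fst.inv.mul continuous_const)
  have hΦ_supp : HasCompactSupport Φ.uncurry :=
    (hasCompactSupport_uncurry_twistedConvolution_integrand F H).mul_right
  have h_left σ : twistedConvolution α μ F H σ * α σ (L (σ⁻¹ * τ)) = ∫ ρ, Φ σ ρ ∂μ :=
    (integral_mul_const_of_integrable
      (integrable_twistedConvolution_integrand_compactlySupported hα F H μ σ)).symm
  calc twistedConvolution α μ (twistedConvolution α μ F H) L τ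
    _ = ∫ σ, ∫ ρ, Φ σ ρ ∂μ ∂μ := integral_congr_ae (.of_forall h_left)
    _ = ∫ ρ, ∫ σ, Φ σ ρ ∂μ ∂μ := integral_integral_swap_of_hasCompactSupport hΦ hΦ_supp
    _ = twistedConvolution α μ F (twistedConvolution α μ H L) τ := integral_congr_ae <|
      .of_forall fun ρ => (action_twistedConvolution_inv_mul hα F H L μ ρ τ).symm

end CompactlySupported

section InversionInvariant

variable [TopologicalSpace K] [IsTopologicalGroup K] [MeasurableSpace K] [BorelSpace K]
  {μ : Measure K} [μ.IsInvInvariant] {F F' H H' : K → A}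

theorem twistedInvolution_congr (hF : F =ᵐ[μ] F') :
    twistedInvolution α F =ᵐ[μ] twistedInvolution α F' := by
  filter_upwards [(Measure.measurePreserving_inv μ).quasiMeasurePreserving.ae hF] with ρ hρ
  simp only [twistedInvolution, hρ]

theorem twistedConvolution_congr [μ.IsMulLeftInvariant] (hF : F =ᵐ[μ] F') (hH : H =ᵐ[μ] H') :
    twistedConvolution α μ F H = twistedConvolution α μ F' H' := by
  ext τ
  refine integral_congr_ae ?_
  filter_upwards [hF, (measurePreserving_inv_mul τ).quasiMeasurePreserving.ae hH] with ρ hρ hρτ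
  rw [hρ, hρτ]

theorem lintegral_enorm_twistedInvolution (F : K → A) :
    ∫⁻ ρ, ‖twistedInvolution α F ρ‖ₑ ∂μ = ∫⁻ ρ, ‖F ρ‖ₑ ∂μ := by
  simp only [enorm_twistedInvolution]
  exact (Measure.measurePreserving_inv μ).lintegral_comp_emb
    (MeasurableEquiv.inv K).measurableEmbedding fun ρ => ‖F ρ‖ₑ

theorem ae_hasSum_twistedInvolution {ι : Type*} {f : ι → K → A}
    (hF : ∀ᵐ ρ ∂μ, HasSum (fun i => f i ρ) (F ρ)) :
    ∀ᵐ ρ ∂μ, HasSum (fun i => twistedInvolution α (f i) ρ) (twistedInvolution α F ρ) := by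
  filter_upwards [(Measure.measurePreserving_inv μ).quasiMeasurePreserving.ae hF] with ρ hρ
  exact hρ.star.map (α ρ) (actionIsometry α ρ).continuous

end InversionInvariant

section Series

variable [TopologicalSpace K] [IsTopologicalGroup K] [MeasurableSpace K] [BorelSpace K]
  {μ : Measure K} {ι κ : Type*} {u : ι → C_c(K, A)}
  {v : κ → C_c(K, A)}

theorem tsum_lintegral_lintegral_enorm_conv [μ.IsHaarMeasure] :
    ∑' p : ι × κ, ∫⁻ τ, ∫⁻ ρ, ‖u p.1 ρ‖ₑ * ‖v p.2 (ρ⁻¹ * τ)‖ₑ ∂μ ∂μ =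
      (∑' i, ∫⁻ ρ, ‖u i ρ‖ₑ ∂μ) * ∑' j, ∫⁻ ρ, ‖v j ρ‖ₑ ∂μ := by
  simp only [lintegral_lintegral_enorm_conv]
  rw [ENNReal.tsum_prod (f := fun i j => (∫⁻ ρ, ‖u i ρ‖ₑ ∂μ) * ∫⁻ ρ, ‖v j ρ‖ₑ ∂μ)]
  simp only [ENNReal.tsum_mul_left, ENNReal.tsum_mul_right]

theorem tsum_lintegral_enorm_twistedConvolution_le [μ.IsHaarMeasure] :
    ∑' p : ι × κ, ∫⁻ τ, ‖twistedConvolution α μ (u p.1) (v p.2) τ‖ₑ ∂μ ≤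
      (∑' i, ∫⁻ ρ, ‖u i ρ‖ₑ ∂μ) * ∑' j, ∫⁻ ρ, ‖v j ρ‖ₑ ∂μ := by
  rw [← tsum_lintegral_lintegral_enorm_conv]
  exact ENNReal.tsum_le_tsum fun p => lintegral_mono fun τ =>
    (enorm_integral_le_lintegral_enorm _).trans <| lintegral_mono fun ρ =>
      enorm_mul_action_le α ρ _ _

variable [Countable ι] [Countable κ]

theorem ae_tsum_lintegral_enorm_conv_ne_top [μ.IsHaarMeasure]
    (hu : ∑' i, ∫⁻ ρ, ‖u i ρ‖ₑ ∂μ ≠ ∞) (hv : ∑' j, ∫⁻ ρ, ‖v j ρ‖ₑ ∂μ ≠ ∞) :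
    ∀ᵐ τ ∂μ, ∑' p : ι × κ, ∫⁻ ρ, ‖u p.1 ρ‖ₑ * ‖v p.2 (ρ⁻¹ * τ)‖ₑ ∂μ ≠ ∞ := by
  have h_meas (p : ι × κ) := measurable_lintegral_enorm_conv (u p.1) (v p.2) (μ := μ)
  refine (ae_lt_top (.tsum h_meas) ?_).mono fun _ hτ => hτ.ne
  rw [lintegral_tsum fun p => (h_meas p).aemeasurable, tsum_lintegral_lintegral_enorm_conv]
  exact ENNReal.mul_ne_top hu hv

variable [μ.IsInvInvariant] {F H : K → A} (hF : ∀ᵐ ρ ∂μ, HasSum (fun i => u i ρ) (F ρ))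
  (hu : ∑' i, ∫⁻ ρ, ‖u i ρ‖ₑ ∂μ ≠ ∞) (hv : ∑' j, ∫⁻ ρ, ‖v j ρ‖ₑ ∂μ ≠ ∞)
  (hH : ∀ᵐ ρ ∂μ, HasSum (fun j => v j ρ) (H ρ))
include hF hu hv hH

theorem ae_hasSum_twistedConvolution_integrand [μ.IsMulLeftInvariant]
    [IsFiniteMeasureOnCompacts μ] (τ : K) :
    ∀ᵐ ρ ∂μ, HasSum (fun p : ι × κ => u p.1 ρ * α ρ (v p.2 (ρ⁻¹ * τ)))
      (F ρ * α ρ (H (ρ⁻¹ * τ))) := by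
  have h_quasi := (measurePreserving_inv_mul (μ := μ) τ).quasiMeasurePreserving
  filter_upwards [hF, h_quasi.ae hH, ae_summable_norm_of_tsum_lintegral_ne_top hu,
    h_quasi.ae (ae_summable_norm_of_tsum_lintegral_ne_top hv)] with ρ hFρ hHρ huρ hvρ
  have hvρ' : Summable fun j => ‖α ρ (v j (ρ⁻¹ * τ))‖ := by
    simpa only [norm_action_apply] using hvρ
  have hHρ' : HasSum (fun j => α ρ (v j (ρ⁻¹ * τ))) (α ρ (H (ρ⁻¹ * τ))) :=
    hHρ.map (α ρ) (actionIsometry α ρ).continuous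
  have h_mul := hasSum_mul_of_summable_norm hFρ hHρ' huρ hvρ'
  exact h_mul

theorem ae_integrable_and_hasSum_twistedConvolution [μ.IsHaarMeasure]
    (hα : IsCStarDynamicalSystem α) :
    ∀ᵐ τ ∂μ, Integrable (fun ρ => F ρ * α ρ (H (ρ⁻¹ * τ))) μ ∧
      HasSum (fun p : ι × κ => twistedConvolution α μ (u p.1) (v p.2) τ)
        (twistedConvolution α μ F H τ) := by
  filter_upwards [ae_tsum_lintegral_enorm_conv_ne_top hu hv] with τ hτ
  have h_meas (p : ι × κ) : AEStronglyMeasurable (fun ρ => u p.1 ρ * α ρ (v p.2 (ρ⁻¹ * τ))) μ :=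
    (integrable_twistedConvolution_integrand_compactlySupported hα (u p.1) (v p.2) μ τ).1
  have h_sum : ∑' p : ι × κ, ∫⁻ ρ, ‖u p.1 ρ * α ρ (v p.2 (ρ⁻¹ * τ))‖ₑ ∂μ ≠ ∞ :=
    ne_top_of_le_ne_top hτ <| ENNReal.tsum_le_tsum fun p => lintegral_mono fun ρ =>
      enorm_mul_action_le α ρ _ _
  have h_hasSum := ae_hasSum_twistedConvolution_integrand (α := α) hF hu hv hH τ
  exact ⟨integrable_of_ae_hasSum h_meas h_sum h_hasSum,
    hasSum_integral_of_ae_hasSum h_meas h_sum h_hasSum⟩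

end Series

section Integrable

variable [TopologicalSpace K] [IsTopologicalGroup K] [MeasurableSpace K] [BorelSpace K]
  {μ : Measure K} [μ.Regular] [μ.IsInvInvariant] {F F' H H' : K → A}
  (hα : IsCStarDynamicalSystem α) (hF : Integrable F μ) (hF' : Integrable F' μ)
  (hH : Integrable H μ) (hH' : Integrable H' μ)

include hα hF in
theorem integrable_twistedInvolution : Integrable (twistedInvolution α F) μ := by
  have := hα.locallyCompact
  obtain ⟨u, hu, hF⟩ := exists_ae_hasSum_compactlySupported hF hF.hasFiniteIntegral
  refine integrable_of_ae_hasSum (f := fun n => twistedInvolution α (u n)) (fun n => ?_) ?_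
    (ae_hasSum_twistedInvolution hF)
  · have h_cont : Continuous (twistedInvolution α (u n)) :=
      continuous_action hα continuous_id ((map_continuous (u n)).comp continuous_inv).star
    refine (h_cont.integrable_of_hasCompactSupport ?_).1
    refine ((u n).hasCompactSupport.comp_homeomorph (Homeomorph.inv K)).mono
      fun ρ hρ h_zero => hρ ?_
    have h_zero' : u n ρ⁻¹ = 0 := h_zero
    rw [twistedInvolution, h_zero', star_zero, map_zero]
  · simpa only [lintegral_enorm_twistedInvolution] using hu.ne

variable [μ.IsHaarMeasure]
include hα hF hH

theorem ae_integrable_twistedConvolution_integrand :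
    ∀ᵐ τ ∂μ, Integrable (fun ρ => F ρ * α ρ (H (ρ⁻¹ * τ))) μ := by
  have := hα.locallyCompact
  obtain ⟨u, hu, hF⟩ := exists_ae_hasSum_compactlySupported hF hF.hasFiniteIntegral
  obtain ⟨v, hv, hH⟩ := exists_ae_hasSum_compactlySupported hH hH.hasFiniteIntegral
  exact (ae_integrable_and_hasSum_twistedConvolution hF hu.ne hv.ne hH hα).mono fun _ h => h.1

theorem exists_ae_hasSum_twistedConvolution {r s : ℝ≥0∞} (hr : ∫⁻ ρ, ‖F ρ‖ₑ ∂μ < r)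
    (hs : ∫⁻ ρ, ‖H ρ‖ₑ ∂μ < s) :
    ∃ w : ℕ × ℕ → C_c(K, A), ∑' p, ∫⁻ τ, ‖w p τ‖ₑ ∂μ ≤ r * s ∧
      ∀ᵐ τ ∂μ, HasSum (fun p => w p τ) (twistedConvolution α μ F H τ) := by
  have := hα.locallyCompact
  obtain ⟨u, hu, hF⟩ := exists_ae_hasSum_compactlySupported hF hr
  obtain ⟨v, hv, hH⟩ := exists_ae_hasSum_compactlySupported hH hs
  refine ⟨fun p => compactlySupportedConvolution hα (u p.1) (v p.2) μ,
    tsum_lintegral_enorm_twistedConvolution_le.trans (mul_le_mul' hu.le hv.le), ?_⟩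
  exact (ae_integrable_and_hasSum_twistedConvolution hF hu.ne_top hv.ne_top hH hα).mono
    fun _ h => h.2

theorem lintegral_enorm_twistedConvolution_le :
    ∫⁻ τ, ‖twistedConvolution α μ F H τ‖ₑ ∂μ ≤ (∫⁻ ρ, ‖F ρ‖ₑ ∂μ) * ∫⁻ ρ, ‖H ρ‖ₑ ∂μ := by
  refine ENNReal.le_mul_of_forall_lt (.inr hH.hasFiniteIntegral.ne) (.inl hF.hasFiniteIntegral.ne)
    fun r hr s hs => ?_
  obtain ⟨w, hw_sum, hw⟩ := exists_ae_hasSum_twistedConvolution hα hF hH hr hs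
  exact (lintegral_enorm_le_tsum_of_ae_hasSum
    (fun p => (integrable_compactlySupported (w p)).1) hw).trans hw_sum

theorem integrable_twistedConvolution : Integrable (twistedConvolution α μ F H) μ := by
  obtain ⟨r, hFr, hr⟩ := exists_between hF.hasFiniteIntegral
  obtain ⟨s, hHs, hs⟩ := exists_between hH.hasFiniteIntegral
  obtain ⟨w, hw_sum, hw⟩ := exists_ae_hasSum_twistedConvolution hα hF hH hFr hHs
  exact integrable_of_ae_hasSum (fun p => (integrable_compactlySupported (w p)).1)
    (ne_top_of_le_ne_top (ENNReal.mul_ne_top hr.ne hs.ne) hw_sum) hw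

include hF' in
theorem twistedConvolution_add_left :
    twistedConvolution α μ (F + F') H =ᵐ[μ]
      twistedConvolution α μ F H + twistedConvolution α μ F' H := by
  filter_upwards [ae_integrable_twistedConvolution_integrand hα hF hH,
    ae_integrable_twistedConvolution_integrand hα hF' hH] with τ hτ hτ'
  simp only [twistedConvolution, Pi.add_apply, add_mul]
  exact integral_add hτ hτ'

include hH' in
theorem twistedConvolution_add_right :
    twistedConvolution α μ F (H + H') =ᵐ[μ]
      twistedConvolution α μ F H + twistedConvolution α μ F H' := by
  filter_upwards [ae_integrable_twistedConvolution_integrand hα hF hH,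
    ae_integrable_twistedConvolution_integrand hα hF hH'] with τ hτ hτ'
  simp only [twistedConvolution, Pi.add_apply, map_add, mul_add]
  exact integral_add hτ hτ'

end Integrable

end TwistedConvolution

section L1

theorem exists_eq_toL1 {X E : Type*} [MeasurableSpace X] {μ : Measure X} [NormedAddCommGroup E]
    (x : X →₁[μ] E) : ∃ (F : X → E) (hF : Integrable F μ), x = hF.toL1 F :=
  ⟨x, L1.integrable_coeFn x, (Integrable.toL1_coeFn x _).symm⟩

theorem denseRange_toL1_compactlySupported {X E : Type*} [TopologicalSpace X] [R1Space X]
    [LocallyCompactSpace X] [MeasurableSpace X] [BorelSpace X] {μ : Measure X} [μ.Regular]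
    [NormedAddCommGroup E] [NormedSpace ℝ E] :
    DenseRange fun g : C_c(X, E) => (integrable_compactlySupported (μ := μ) g).toL1 g := by
  intro x
  obtain ⟨F, hF, rfl⟩ := exists_eq_toL1 x
  refine EMetric.mem_closure_iff.2 fun ε hε => ?_
  obtain ⟨δ, hδ, hδε⟩ := exists_between hε
  obtain ⟨g, hg⟩ := exists_compactlySupported_eLpNorm_sub_le ENNReal.one_ne_top
    (memLp_one_iff_integrable.2 hF) hδ.ne'
  refine ⟨_, ⟨g, rfl⟩, lt_of_le_of_lt ?_ hδε⟩
  rw [Integrable.edist_toL1_toL1]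
  simpa only [edist_eq_enorm_sub, eLpNorm_one_eq_lintegral_enorm] using hg

variable {K : Type*} [Group K] [TopologicalSpace K] [IsTopologicalGroup K] [MeasurableSpace K]
  [BorelSpace K] {μ : Measure K} [μ.Regular] [μ.IsInvInvariant] {A : Type*}
  [NonUnitalCStarAlgebra A] {α : K →* (A ≃⋆ₐ[ℂ] A)} (hα : IsCStarDynamicalSystem α)

theorem norm_toL1_twistedInvolution {F : K → A} (hF : Integrable F μ) :
    ‖(integrable_twistedInvolution hα hF).toL1 _‖ = ‖hF.toL1 F‖ := by
  rw [Integrable.norm_toL1_eq_lintegral_enorm, lintegral_enorm_twistedInvolution,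
    Integrable.norm_toL1_eq_lintegral_enorm]

/-- The twisted involution on the classes of integrable functions, as a conjugate linear isometry
of `L¹(K, A)`. -/
noncomputable def involutionL1 : (K →₁[μ] A) →ₗᵢ⋆[ℂ] (K →₁[μ] A) where
  toFun x := (integrable_twistedInvolution hα (L1.integrable_coeFn x)).toL1 _
  map_add' x y := by
    rw [← Integrable.toL1_add, Integrable.toL1_eq_toL1_iff, ← twistedInvolution_add]
    exact twistedInvolution_congr (Lp.coeFn_add x y)
  map_smul' c x := by
    rw [← Integrable.toL1_smul', Integrable.toL1_eq_toL1_iff, starRingEnd_apply,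
      ← twistedInvolution_smul]
    exact twistedInvolution_congr (Lp.coeFn_smul c x)
  norm_map' x := (norm_toL1_twistedInvolution hα (L1.integrable_coeFn x)).trans <| by
    rw [Integrable.toL1_coeFn]

theorem involutionL1_toL1 {F : K → A} (hF : Integrable F μ) :
    involutionL1 hα (hF.toL1 F) = (integrable_twistedInvolution hα hF).toL1 _ :=
  (Integrable.toL1_eq_toL1_iff _ _ (integrable_twistedInvolution hα (L1.integrable_coeFn _)) _).2 <|
    twistedInvolution_congr hF.coeFn_toL1

theorem involutionL1_involutionL1 (x : K →₁[μ] A) :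
    involutionL1 hα (involutionL1 hα x) = x := by
  obtain ⟨F, hF, rfl⟩ := exists_eq_toL1 x
  rw [involutionL1_toL1, involutionL1_toL1, Integrable.toL1_eq_toL1_iff,
    twistedInvolution_twistedInvolution]

variable [μ.IsHaarMeasure]

theorem norm_toL1_twistedConvolution_le {F H : K → A} (hF : Integrable F μ) (hH : Integrable H μ) :
    ‖(integrable_twistedConvolution hα hF hH).toL1 _‖ ≤ ‖hF.toL1 F‖ * ‖hH.toL1 H‖ := by
  simp only [Integrable.norm_toL1_eq_lintegral_enorm, ← ENNReal.toReal_mul]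
  exact ENNReal.toReal_mono (ENNReal.mul_ne_top hF.hasFiniteIntegral.ne hH.hasFiniteIntegral.ne)
    (lintegral_enorm_twistedConvolution_le hα hF hH)

/-- The twisted convolution on the classes of integrable functions, as a continuous bilinear map
on `L¹(K, A)`. -/
noncomputable def convolutionL1 : (K →₁[μ] A) →L[ℂ] (K →₁[μ] A) →L[ℂ] (K →₁[μ] A) :=
  LinearMap.mkContinuous₂
    (LinearMap.mk₂ ℂ
      (fun x y =>
        (integrable_twistedConvolution hα (L1.integrable_coeFn x) (L1.integrable_coeFn y)).toL1 _)
      (fun x x' y => by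
        rw [← Integrable.toL1_add, Integrable.toL1_eq_toL1_iff,
          twistedConvolution_congr (Lp.coeFn_add x x') .rfl]
        exact twistedConvolution_add_left hα (L1.integrable_coeFn x) (L1.integrable_coeFn x')
          (L1.integrable_coeFn y))
      (fun c x y => by
        rw [← Integrable.toL1_smul', Integrable.toL1_eq_toL1_iff,
          twistedConvolution_congr (Lp.coeFn_smul c x) .rfl, twistedConvolution_smul_left])
      (fun x y y' => by
        rw [← Integrable.toL1_add, Integrable.toL1_eq_toL1_iff,
          twistedConvolution_congr .rfl (Lp.coeFn_add y y')]
        exact twistedConvolution_add_right hα (L1.integrable_coeFn x) (L1.integrable_coeFn y)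
          (L1.integrable_coeFn y'))
      (fun c x y => by
        rw [← Integrable.toL1_smul', Integrable.toL1_eq_toL1_iff,
          twistedConvolution_congr .rfl (Lp.coeFn_smul c y), twistedConvolution_smul_right]))
    1 fun x y =>
      (norm_toL1_twistedConvolution_le hα (L1.integrable_coeFn x) (L1.integrable_coeFn y)).trans <|
        by rw [one_mul, Integrable.toL1_coeFn, Integrable.toL1_coeFn]

theorem convolutionL1_toL1 {F H : K → A} (hF : Integrable F μ) (hH : Integrable H μ) :
    convolutionL1 hα (hF.toL1 F) (hH.toL1 H) = (integrable_twistedConvolution hα hF hH).toL1 _ :=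
  (Integrable.toL1_eq_toL1_iff _ _
    (integrable_twistedConvolution hα (L1.integrable_coeFn _) (L1.integrable_coeFn _)) _).2 <|
    .of_eq <| twistedConvolution_congr hF.coeFn_toL1 hH.coeFn_toL1

theorem norm_convolutionL1_apply_le (x y : K →₁[μ] A) :
    ‖convolutionL1 hα x y‖ ≤ ‖x‖ * ‖y‖ := by
  obtain ⟨F, hF, rfl⟩ := exists_eq_toL1 x
  obtain ⟨H, hH, rfl⟩ := exists_eq_toL1 y
  rw [convolutionL1_toL1]
  exact norm_toL1_twistedConvolution_le hα hF hH

theorem convolutionL1_assoc (x y z : K →₁[μ] A) :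
    convolutionL1 hα (convolutionL1 hα x y) z = convolutionL1 hα x (convolutionL1 hα y z) := by
  have := hα.locallyCompact
  refine denseRange_toL1_compactlySupported.induction_on₃ (p := fun x y z =>
    convolutionL1 hα (convolutionL1 hα x y) z = convolutionL1 hα x (convolutionL1 hα y z))
    (isClosed_eq (by fun_prop) (by fun_prop)) (fun F H L => ?_) x y z
  simp only [convolutionL1_toL1]
  rw [Integrable.toL1_eq_toL1_iff, twistedConvolution_assoc_compactlySupported hα]

theorem involutionL1_convolutionL1 (x y : K →₁[μ] A) :
    involutionL1 hα (convolutionL1 hα x y) =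
      convolutionL1 hα (involutionL1 hα y) (involutionL1 hα x) := by
  obtain ⟨F, hF, rfl⟩ := exists_eq_toL1 x
  obtain ⟨H, hH, rfl⟩ := exists_eq_toL1 y
  simp only [convolutionL1_toL1, involutionL1_toL1]
  rw [Integrable.toL1_eq_toL1_iff, twistedInvolution_twistedConvolution]

theorem isBanachStarAlgebra_convolutionL1 :
    IsBanachStarAlgebra (fun x y : K →₁[μ] A => convolutionL1 hα x y) (involutionL1 hα) where
  complete := inferInstance
  add_mul := (convolutionL1 hα).map_add₂
  mul_add x := map_add (convolutionL1 hα x)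
  smul_mul := (convolutionL1 hα).map_smul₂
  mul_smul c x := map_smul (convolutionL1 hα x) c
  mul_assoc := convolutionL1_assoc hα
  norm_mul_le := norm_convolutionL1_apply_le hα
  inv_inv := involutionL1_involutionL1 hα
  inv_add := map_add (involutionL1 hα)
  inv_smul := map_smulₛₗ (involutionL1 hα)
  inv_mul := involutionL1_convolutionL1 hα
  norm_inv := (involutionL1 hα).norm_map

variable (μ) in
include hα in
theorem isTwistedConvolutionAlgebra : IsTwistedConvolutionAlgebra α μ := by
  refine ⟨fun x y => convolutionL1 hα x y, involutionL1 hα,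
    fun F H hF hH => ⟨ae_integrable_twistedConvolution_integrand hα hF hH, ?_⟩,
    fun F hF => ?_, isBanachStarAlgebra_convolutionL1 hα⟩
  · simpa only [convolutionL1_toL1] using Integrable.coeFn_toL1 _
  · simpa only [involutionL1_toL1] using Integrable.coeFn_toL1 _

end L1

end HolonomyFlux

theorem mainTheorem10_general
    {M : Type u} [TopologicalSpace M]
    {G : Type v} [Group G] [TopologicalSpace G] [IsTopologicalGroup G] [LocallyCompactSpace G]
    (unimodular : ∀ g : G, Measure.modularCharacter g = 1)
    {N : ℕ} (Γ : Graph M N) (S : Fin N → OrientedSurface M)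
    (hS : SimpleSurfaceIntersectionProperty Γ S)
    [MeasurableSpace (fluxGroup G Γ S)] [BorelSpace (fluxGroup G Γ S)]
    (μ : Measure (fluxGroup G Γ S)) [μ.IsHaarMeasure] [μ.Regular] :
    IsCStarDynamicalSystem (leftAction (G := G) Γ S) ∧
      ∀ {A : Type*} [NonUnitalCStarAlgebra A] (α : fluxGroup G Γ S →* (A ≃⋆ₐ[ℂ] A)),
        IsCStarDynamicalSystem α → IsTwistedConvolutionAlgebra α μ := by
  let e := ingoingFluxEquiv G hS
  have : LocallyCompactSpace (fluxGroup G Γ S) :=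
    e.toHomeomorph.isClosedEmbedding.locallyCompactSpace
  have h_unimodular (ρ : fluxGroup G Γ S) : Measure.modularCharacter ρ = 1 := by
    rw [← modularCharacter_map e, modularCharacter_pi]
    exact Finset.prod_eq_one fun i _ => unimodular _
  have := isMulRightInvariant_of_modularCharacter_eq_one μ h_unimodular
  have := isInvInvariant_of_isMulRightInvariant μ
  exact ⟨⟨inferInstance, continuous_leftAction_apply⟩, fun _ hα => isTwistedConvolutionAlgebra μ hα⟩

theorem mainTheorem10
    {M : Type u} [TopologicalSpace M]
    {G : Type v} [Group G] [TopologicalSpace G] [IsTopologicalGroup G] [T2Space G]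
    [LocallyCompactSpace G]
    (unimodular : ∀ g : G, Measure.modularCharacter g = 1)
    {N : ℕ} (Γ : Graph M N) (S : Fin N → OrientedSurface M)
    (hS : SimpleSurfaceIntersectionProperty Γ S)
    [MeasurableSpace (fluxGroup G Γ S)] [BorelSpace (fluxGroup G Γ S)]
    (μ : Measure (fluxGroup G Γ S)) [μ.IsHaarMeasure] [μ.Regular] :
    IsCStarDynamicalSystem (leftAction (G := G) Γ S) ∧
      IsTwistedConvolutionAlgebra (leftAction (G := G) Γ S) μ ∧
      ∀ α : fluxGroup G Γ S →* (C₀(configSpace G Γ, ℂ) ≃⋆ₐ[ℂ] C₀(configSpace G Γ, ℂ)),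
        IsCStarDynamicalSystem α → IsTwistedConvolutionAlgebra α μ := by
  obtain ⟨h_left, h_all⟩ := mainTheorem10_general unimodular Γ S hS μ
  exact ⟨h_left, h_all _ h_left, h_all⟩
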